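/- Let $p\ge 0$, $I=\{1,\dots,p\}$ and $K,K'\subseteq I$ (possibly empty). Let $\mathcal C_p$ be the set of cumulative distribution functions (cdfs) $F(\mathbf u)=\mu([\mathbf 0,\mathbf u])$ of probability measures $\mu$ on the closed cube $[0,1]^p$. For a function $F$ on $[0,1]^p$ write $F_K(\mathbf u_K)$ for its value at the point whose coordinates in $K$ are $\mathbf u_K$ and whose other coordinates are $1$. Let $\psi:[0,1]^p\to\mathbb R$ be continuous, and for $F\in\mathcal C_p$ put $$\Psi_{K,K'}(F)=\int \psi(\mathbf u)\,F_K(\mathbf u_K)\,F_{K'}(d\mathbf u_{K'})\,d\mathbf u_{I\setminus K'},$$ the integral being over $[0,1]^p$, where $F_{K'}(d\mathbf u_{K'})$ is the probability measure on $[0,1]^{K'}$ with cdf $F_{K'}$. Let $C$ be a $p$-dimensional copula (a cdf in $\mathcal C_p$ with uniform univariate margins) such that $$\chi(\mathbf u_{K'})=\int\psi(\mathbf u)\,C_K(\mathbf u_K)\,d\mathbf u_{I\setminus K'}$$ is of bounded variation on $[0,1]^{K'}$ in the sense of Hardy and Krause. Then $\Psi_{K,K'}:\mathcal C_p\to\mathbb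 R$ is Hadamard differentiable at $C$ tangentially to the set $C([0,1]^p)$ of continuous functions (with the sup-norm): there is a continuous linear map $\Psi_{K,K'}'(C):C([0,1]^p)\to\mathbb R$ such that, for all real $t_n\to0$ with $t_n\ne0$, and all functions $h_n$ on $[0,1]^p$ with $C+t_nh_n\in\mathcal C_p$ that converge uniformly to a continuous function $h$, $$\frac{\Psi_{K,K'}(C+t_nh_n)-\Psi_{K,K'}(C)}{t_n}\longrightarrow \Psi_{K,K'}'(C)(h).$$ Moreover, for every continuous $h:[0,1]^p\to\mathbb R$, $$\Psi_{K,K'}'(C)(h)=\int\psi(\mathbf u)\,h_K(\mathbf u_K)\,C_{K'}(d\mathbf u_{K'})\,d\mathbf u_{I\setminus K'}+\int\chi(\mathbf u_{K'})\,h_{K'}(d\mathbf u_{K'}).$$ Here the first (resp. second) integral is read as $0$ if $K=\emptyset$ (resp. $K'=\emptyset$), since then $F_K$ (resp. $F_{K'}$) is the constant $1$ for every cdf $F$. The second integral is defined by integration by parts, as $$\int\chi\,dh_{K'}:=\sum_{L\subseteq K'}(-1)^{|L|}\int_{[0,1]^L}h_{K'}(\mathbf y_L,\mathbf 1_{K'\setminus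 L})\,\chi(d\mathbf y_L,\mathbf 1_{K'\setminus L}),$$ where the integrals on the right exist as multivariate Riemann–Stieltjes integrals. This value is the usual integral $\int\chi\,d\mu_1-\int\chi\,d\mu_2$ whenever $h_{K'}(\mathbf v)=\mu_1([\mathbf 0,\mathbf v])-\mu_2([\mathbf 0,\mathbf v])$ for all $\mathbf v$, for finite measures $\mu_1,\mu_2$ on $[0,1]^{K'}$. -/

import Mathlib

open MeasureTheory Filter Topology Set
open scoped unitInterval

noncomputable section

namespace HadamardCopula

variable {ι : Type*} [Fintype ι] [DecidableEq ι]

/-! ### Distribution functions and copulas on the closed cube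

The cube `[0,1]^ι` is the type `ι → I`, where `I` is the unit interval. -/

/-- `F` is the cumulative distribution function of the measure `μ` on the cube. -/
def IsCdfOf {ι : Type*} (F : (ι → I) → ℝ) (μ : Measure (ι → I)) : Prop :=
  ∀ u, F u = μ.real (Iic u)

/-- The set of cumulative distribution functions of probability measures on the cube. -/
def cdfs (ι : Type*) [Fintype ι] : Set ((ι → I) → ℝ) :=
  {F | ∃ μ : Measure (ι → I), IsProbabilityMeasure μ ∧ IsCdfOf F μ}

open Classical in
/-- The probability measure `F(du)` of a cumulative distribution function `F`
(and `0` if `F` is not one). It is unique: see `cdfMeasure_eq`. -/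
def cdfMeasure {ι : Type*} [Fintype ι] (F : (ι → I) → ℝ) : Measure (ι → I) :=
  if hF : ∃ μ : Measure (ι → I), IsProbabilityMeasure μ ∧ IsCdfOf F μ then hF.choose else 0

theorem measure_ext_Iic {ι : Type*} [Fintype ι] {μ ν : Measure (ι → I)} [IsFiniteMeasure μ]
    (h : ∀ u, μ (Iic u) = ν (Iic u)) : μ = ν := by
  have hspan : ∀ _ : ι, IsCountablySpanning (range (Iic : I → Set I)) := fun _ =>
    ⟨fun _ => Iic 1, fun _ => ⟨1, rfl⟩, by
      ext x
      simpa using unitInterval.le_one'⟩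
  have hgen := generateFrom_eq_pi
    (C := fun _ : ι => range (Iic : I → Set I))
    (fun _ => (borel_eq_generateFrom_Iic I).symm.trans (BorelSpace.measurable_eq).symm) hspan
  refine ext_of_generate_finite _ hgen.symm
    (IsPiSystem.pi fun _ => by
      simpa only [image_univ] using isPiSystem_image_Iic (univ : Set I)) ?_ ?_
  · rintro s ⟨t, ht, rfl⟩
    have ht' : ∀ i, ∃ a, Iic a = t i := fun i => ht i (mem_univ i)
    choose a ha using ht'
    have : univ.pi t = Iic a := by
      rw [← pi_univ_Iic]
      exact congrArg _ (funext fun i => (ha i).symm)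
    rw [this]
    exact h a
  · have : (univ : Set (ι → I)) = Iic 1 := by
      ext x
      exact ⟨fun _ => fun i => unitInterval.le_one', fun _ => trivial⟩
    rw [this]
    exact h 1

theorem cdfMeasure_eq {ι : Type*} [Fintype ι] {F : (ι → I) → ℝ} {μ : Measure (ι → I)}
    (hμ : IsProbabilityMeasure μ) (hF : IsCdfOf F μ) : cdfMeasure F = μ := by
  have hex : ∃ μ : Measure (ι → I), IsProbabilityMeasure μ ∧ IsCdfOf F μ := ⟨μ, hμ, hF⟩
  have hc : cdfMeasure F = hex.choose := dif_pos hex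
  obtain ⟨h1, h2⟩ := hex.choose_spec
  rw [hc]
  refine measure_ext_Iic fun u => ?_
  have := (h2 u).symm.trans (hF u)
  simpa [measureReal_def, ENNReal.toReal_eq_toReal_iff' (measure_ne_top _ _) (measure_ne_top _ _)]
    using this

/-- A copula: a cumulative distribution function on the cube with uniform one-dimensional
margins. -/
def IsCopula (C : (ι → I) → ℝ) : Prop :=
  C ∈ cdfs ι ∧ ∀ (i : ι) (s : I), C (Function.update 1 i s) = s

/-- The `K`-margin `F_K(v) = F(v, 1)`: the coordinates outside `K` are set to `1`. -/
def margin (K : Finset ι) (F : (ι → I) → ℝ) : (K → I) → ℝ :=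
  fun v => F fun i => if hi : i ∈ K then v ⟨i, hi⟩ else 1

/-! ### The map -/

/-- The point of the cube with coordinates `v` in `K'` and `w` outside `K'`. -/
def glue (K' : Finset ι) (v : K' → I) (w : {i // i ∉ K'} → I) : ι → I :=
  fun i => if hi : i ∈ K' then v ⟨i, hi⟩ else w ⟨i, hi⟩

/-- `χ_F(v) = ∫ ψ(u) F_K(u_K) du_{I ∖ K'}`, where `v = u_{K'}` is kept fixed. -/
def chi (ψ : (ι → I) → ℝ) (K K' : Finset ι) (F : (ι → I) → ℝ) (v : K' → I) : ℝ :=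
  ∫ w : {i // i ∉ K'} → I, ψ (glue K' v w) * margin K F (fun i => glue K' v w i)

/-- `Ψ_{K,K'}(F) = ∫ ψ(u) F_K(u_K) F_{K'}(du_{K'}) du_{I ∖ K'}`. -/
def Psi (ψ : (ι → I) → ℝ) (K K' : Finset ι) (F : (ι → I) → ℝ) : ℝ :=
  ∫ v, chi ψ K K' F v ∂(cdfMeasure (margin K' F))

/-! ### Bounded variation and Stieltjes integrals on the cube -/

/-- A grid on the cube: in each coordinate `i` a ladder
`0 = pts i 0 ≤ pts i 1 ≤ ... ≤ pts i n = 1`. Its cells are indexed by `k : ι → Fin n`, the cell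
`k` being the product of the intervals from `pts i (k i)` to `pts i (k i + 1)`. -/
structure Grid (ι : Type*) where
  n : ℕ
  pts : ι → ℕ → I
  mono : ∀ i, Monotone (pts i)
  first : ∀ i, pts i 0 = 0
  last : ∀ i, pts i n = 1

/-- Lower corner of a cell. -/
def Grid.lower (P : Grid ι) (k : ι → Fin P.n) : ι → I := fun i => P.pts i (k i : ℕ)

/-- Upper corner of a cell. -/
def Grid.upper (P : Grid ι) (k : ι → Fin P.n) : ι → I := fun i => P.pts i ((k i : ℕ) + 1)

/-- The increment of `g` over the box with lower corner `a` and upper corner `b`: the alternating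
sum of the values of `g` at the vertices of the box. -/
def boxIncrement (g : (ι → I) → ℝ) (a b : ι → I) : ℝ :=
  ∑ S : Finset ι, (-1 : ℝ) ^ (Sᶜ).card * g fun i => if i ∈ S then b i else a i

/-- Bounded variation in the sense of Vitali. -/
def IsVitaliBV (g : (ι → I) → ℝ) : Prop :=
  ∃ M : ℝ, ∀ P : Grid ι,
    ∑ k : ι → Fin P.n, |boxIncrement g (P.lower k) (P.upper k)| ≤ M

/-- Bounded variation in the sense of Hardy and Krause: for every nonempty set `L` of coordinates,
the function obtained by fixing the coordinates outside `L` at `1` has bounded Vitali variation. -/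
def IsHardyKrauseBV (g : (ι → I) → ℝ) : Prop :=
  ∀ L : Finset ι, L.Nonempty → IsVitaliBV (margin L g)

/-- The Riemann-Stieltjes integral of `f` with respect to `g` over the cube exists and equals
`J`. -/
def HasStieltjesIntegral (f g : (ι → I) → ℝ) (J : ℝ) : Prop :=
  ∀ ε > 0, ∃ δ > 0, ∀ (P : Grid ι) (ξ : (ι → Fin P.n) → ι → I),
    (∀ k, ξ k ∈ Icc (P.lower k) (P.upper k)) →
    (∀ k i, (P.upper k i : ℝ) - P.lower k i < δ) →
    |∑ k : ι → Fin P.n, f (ξ k) * boxIncrement g (P.lower k) (P.upper k) - J| < ε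

/-- The integral `∫ g dh` over the closed cube exists, in the sense of integration by parts, and
equals `J`:
`J = ∑_L (-1)^|L| ∫_{[0,1]^L} h(y_L, 1) g(dy_L, 1)`, the sum running over all sets `L` of
coordinates, with all the coordinates outside `L` set to `1`. The term of `L = ∅` is
`h(1) g(1)`. There is no term with a coordinate set to `0`, since `h(dv)` is a (generalized)
measure on the closed cube, that gives the mass `h(v)` to `[0,v]`, also if some `v i` is `0`. -/
def HasIntegralByParts (g h : (ι → I) → ℝ) (J : ℝ) : Prop :=
  ∃ T : Finset ι → ℝ,
    (∀ L, HasStieltjesIntegral (margin L h) (margin L g) (T L)) ∧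
    J = ∑ L : Finset ι, (-1 : ℝ) ^ L.card * T L

/-! ### Hadamard differentiability -/

/-- `Φ`, defined on the set `𝒟` of real functions on `X`, is Hadamard differentiable at `θ`,
tangentially to the continuous functions, with derivative `D`, a continuous linear map. The
functions carry the supremum norm. -/
def HasHadamardDerivAt {X : Type*} [TopologicalSpace X] (𝒟 : Set (X → ℝ)) (Φ : (X → ℝ) → ℝ)
    (D : C(X, ℝ) →L[ℝ] ℝ) (θ : X → ℝ) : Prop :=
  ∀ (t : ℕ → ℝ) (hs : ℕ → X → ℝ) (h : C(X, ℝ)),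
    (∀ n, t n ≠ 0) → Tendsto t atTop (𝓝 0) →
    TendstoUniformly hs h atTop → (∀ n, θ + t n • hs n ∈ 𝒟) →
    Tendsto (fun n => (Φ (θ + t n • hs n) - Φ θ) / t n) atTop (𝓝 (D h))

end HadamardCopula

end

/-! Put F = C + t_n h_n. The difference quotient is the sum of ∫(χ_F − χ_C) dF_{K'} / t_n and (∫χ_C
dF_{K'} − ∫χ_C dC_{K'}) / t_n. In the first, χ is linear and sup-norm bounded in its function, so up
to o(1) it is ∫χ_h dF_{K'}; here χ_h is continuous and F_{K'} converges weakly to C_{K'}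
(`tendsto_integral_of_tendsto_cdf`). In the second, ∫χ_C dG must be controlled by the sup-norm of G
alone, which is what Hardy-Krause variation provides.

The engine is a discrete integration by parts. The cdf of the point mass at x is the indicator of
[x,1], and its by-parts sum against f on a grid is exactly f(y), with y the point x rounded up to
the grid (`exists_byPartsSum_indicator`). Integrating over x, the by-parts sum of the cdf of μ is ∫f
dμ up to the oscillation of f (`abs_integral_sub_byPartsSum_le`). The same sum is linear in the cdf,
bounded by its sup-norm uniformly in the grid (`IsHardyKrauseBV.exists_abs_byPartsSum_le`), and for
continuous h converges to the integral by parts J. In the limit, |∫χ dμ₁ − ∫χ dμ₂ − tJ| ≤ V sup|G₁ −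
G₂ − th|, where G₁, G₂ are the cdfs (`abs_integral_sub_integral_sub_le`). With t = t_n this settles
the second quotient; with t = 1 and bound 0 it identifies J for differences of measures.

Alternating sums over vertices are treated as products: a box increment is the multilinear extension
of g at the differences δ_b − δ_a, so additivity and summation by parts are expansions of products.
-/

noncomputable section

namespace HadamardCopula

variable {ι : Type*} [Fintype ι] [DecidableEq ι]

/-! ### Multilinear calculus of box increments -/

/-- The formal unit point mass at `x`. -/
def pointMass (x : I) : Π₀ _ : I, ℝ :=
  open Classical in DFinsupp.single x 1

open Classical in
/-- The integral of `g` with respect to a product of finitely supported signed measures on `I`,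
as a multilinear map of the factors. -/
def multiEval (g : (ι → I) → ℝ) : MultilinearMap ℝ (fun _ : ι => Π₀ _ : I, ℝ) ℝ :=
  (DFinsupp.lsum ℝ fun p => g p • (LinearMap.id : ℝ →ₗ[ℝ] ℝ)).compMultilinearMap
    (MultilinearMap.dfinsuppFamily fun _ : ι → I => MultilinearMap.mkPiAlgebra ℝ ι ℝ)

theorem multiEval_pointMass (g : (ι → I) → ℝ) (x : ι → I) :
    multiEval g (fun i => pointMass (x i)) = g x := by
  classical
  simp only [multiEval, pointMass, LinearMap.compMultilinearMap_apply]
  rw [MultilinearMap.dfinsuppFamily_single]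
  simp

-- Point masses span the finitely supported measures, so they determine a multilinear map.
omit [DecidableEq ι] in
theorem multiEval_ext {f f' : MultilinearMap ℝ (fun _ : ι => Π₀ _ : I, ℝ) ℝ}
    (h : ∀ x : ι → I, f (fun i => pointMass (x i)) = f' (fun i => pointMass (x i))) : f = f' := by
  classical
  refine MultilinearMap.dfinsupp_ext fun p => MultilinearMap.ext fun c => ?_
  have hc : ∀ i, (DFinsupp.lsingle (R := ℝ) (M := fun _ : I => ℝ) (p i)) (c i) =
      c i • pointMass (p i) := fun i => by
    simp only [pointMass, DFinsupp.lsingle_apply]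
    rw [← DFinsupp.single_smul, smul_eq_mul, mul_one]
  simp only [MultilinearMap.compLinearMap_apply, hc, MultilinearMap.map_smul_univ]
  rw [h p]

/-- The expansion of a multilinear map at a difference of two families. -/
theorem map_sub_univ {M : ι → Type*} [∀ i, AddCommGroup (M i)] [∀ i, Module ℝ (M i)]
    (f : MultilinearMap ℝ M ℝ) (m m' : ∀ i, M i) :
    f (fun i => m i - m' i) =
      ∑ S : Finset ι, (-1 : ℝ) ^ S.card * f (fun i => if i ∈ S then m' i else m i) := by
  have h1 : (fun i => m i - m' i) = (fun i => (-1 : ℝ) • m' i) + m := by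
    ext i
    simp [sub_eq_neg_add]
  rw [h1, MultilinearMap.map_add_univ]
  refine Finset.sum_congr rfl fun S _ => ?_
  have h2 : S.piecewise (fun i => (-1 : ℝ) • m' i) m =
      fun i => (if i ∈ S then (-1 : ℝ) else 1) • (if i ∈ S then m' i else m i) := by
    ext i
    by_cases hi : i ∈ S <;> simp [hi]
  rw [h2, MultilinearMap.map_smul_univ, smul_eq_mul]
  simp

/-- Expanding the product of the δ_b − δ_a gives the signed vertices of the box. -/
theorem boxIncrement_eq_multiEval (g : (ι → I) → ℝ) (a b : ι → I) :
    boxIncrement g a b = multiEval g (fun i => pointMass (b i) - pointMass (a i)) := by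
  rw [map_sub_univ, boxIncrement]
  refine Fintype.sum_equiv compl_involutive.toPerm _ _ fun S => ?_
  rw [← multiEval_pointMass g]
  simp only [Function.Involutive.coe_toPerm, Finset.mem_compl]
  congr 2
  ext1 i
  by_cases hi : i ∈ S <;> simp [hi]

/-- Fixing a coordinate at 1 means inserting δ_1 in that slot; both sides are multilinear, so point
masses suffice. -/
theorem multiEval_margin (L : Finset ι) (g : (ι → I) → ℝ) (w : L → Π₀ _ : I, ℝ) :
    multiEval (margin L g) w =
      multiEval g (fun i => if hi : i ∈ L then w ⟨i, hi⟩ else pointMass 1) := by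
  have h : multiEval (margin L g) =
      (multiEval g).domDomRestrict (· ∈ L) (fun _ => pointMass 1) := by
    refine multiEval_ext fun x => ?_
    rw [multiEval_pointMass, margin, ← multiEval_pointMass g, MultilinearMap.domDomRestrict_apply]
    congr 1
    ext1 i
    by_cases hi : i ∈ L <;> simp [hi]
  rw [h, MultilinearMap.domDomRestrict_apply]

/-- A box increment vanishes if the box is degenerate. -/
theorem boxIncrement_eq_zero (g : (ι → I) → ℝ) {a b : ι → I} (i : ι) (h : a i = b i) :
    boxIncrement g a b = 0 := by
  rw [boxIncrement_eq_multiEval]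
  exact MultilinearMap.map_coord_zero _ i (by simp [h])

theorem sum_pointMass_sub (c : ℕ → I) (n : ℕ) :
    ∑ j : Fin n, (pointMass (c (j + 1)) - pointMass (c j)) = pointMass (c n) - pointMass (c 0) := by
  rw [Fin.sum_univ_eq_sum_range (fun j => pointMass (c (j + 1)) - pointMass (c j)),
    Finset.sum_range_sub (fun j => pointMass (c j))]

/-- Box increments are additive over the cells of a grid of the box. -/
theorem sum_boxIncrement (g : (ι → I) → ℝ) (n : ℕ) (c : ι → ℕ → I) :
    ∑ k : ι → Fin n, boxIncrement g (fun i => c i (k i)) (fun i => c i (k i + 1)) =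
      boxIncrement g (fun i => c i 0) (fun i => c i n) := by
  simp only [boxIncrement_eq_multiEval]
  rw [← MultilinearMap.map_sum (multiEval g)
    (fun i (j : Fin n) => pointMass (c i (j + 1)) - pointMass (c i j))]
  congr 1
  ext1 i
  exact sum_pointMass_sub (c i) n

/-- The grid of the face of the cube with coordinates in `L`. -/
def Grid.restrict (P : Grid ι) (L : Finset ι) : Grid L where
  n := P.n
  pts i := P.pts i
  mono i := P.mono i
  first i := P.first i
  last i := P.last i

/-- The mesh of the grid is less than `δ`. -/
def Grid.MeshLT (P : Grid ι) (δ : ℝ) : Prop :=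
  ∀ i, ∀ j < P.n, (P.pts i (j + 1) : ℝ) - P.pts i j < δ

omit [Fintype ι] [DecidableEq ι] in
/-- The least point of a ladder that is not less than a given point. -/
theorem Grid.exists_ceil (P : Grid ι) {δ : ℝ} (hδ : 0 < δ) (hP : P.MeshLT δ) (i : ι) (x : I) :
    ∃ m ≤ P.n, (∀ j, x ≤ P.pts i j ↔ m ≤ j) ∧ |(P.pts i m : ℝ) - x| < δ := by
  classical
  have hex : ∃ m, x ≤ P.pts i m := ⟨P.n, by rw [P.last]; exact unitInterval.le_one'⟩
  have hspec := Nat.find_spec hex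
  refine ⟨Nat.find hex, Nat.find_min' hex (by rw [P.last]; exact unitInterval.le_one'),
    fun j => ⟨fun hj => Nat.find_min' hex hj, fun hj => hspec.trans (P.mono i hj)⟩, ?_⟩
  have hspec' : (x : ℝ) ≤ P.pts i (Nat.find hex) := hspec
  rw [abs_of_nonneg (by linarith)]
  -- If the index is 0, the ladder point is 0 and so is x. Otherwise the preceding point lies below
  -- x, and the gap is at most one mesh step.
  rcases hm : Nat.find hex with _ | m
  · rw [P.first]
    have := x.2.1
    simp
    linarith
  · have h1 : ¬ x ≤ P.pts i m := Nat.find_min hex (by omega)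
    have h1' : (P.pts i m : ℝ) < x := not_le.mp h1
    have h2 := hP i m (by
      have := Nat.find_min' hex (m := P.n) (by rw [P.last]; exact unitInterval.le_one')
      omega)
    linarith

/-- The sum that corresponds to the integral by parts of `f` with respect to `h`, on a grid. -/
def byPartsSum (P : Grid ι) (h f : (ι → I) → ℝ) : ℝ :=
  ∑ L : Finset ι, (-1 : ℝ) ^ L.card * ∑ k : L → Fin (P.restrict L).n,
    margin L h ((P.restrict L).lower k) *
      boxIncrement (margin L f) ((P.restrict L).lower k) ((P.restrict L).upper k)

theorem sum_indicator_pointMass (c : ℕ → I) {m n : ℕ} (hmn : m ≤ n) :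
    ∑ j : Fin n, (if m ≤ (j : ℕ) then (1 : ℝ) else 0) • (pointMass (c (j + 1)) - pointMass (c j)) =
      pointMass (c n) - pointMass (c m) := by
  induction n, hmn using Nat.le_induction with
  | base =>
    rw [sub_self]
    refine Finset.sum_eq_zero fun j _ => ?_
    rw [if_neg (by have := j.2; omega)]
    simp
  | succ n hmn ih =>
    rw [Fin.sum_univ_castSucc]
    simp only [Fin.val_castSucc, Fin.val_last, if_pos hmn, one_smul]
    rw [ih]
    abel

/-- Summation by parts for a point mass. -/
theorem exists_byPartsSum_indicator (P : Grid ι) {δ : ℝ} (hδ : 0 < δ) (hP : P.MeshLT δ)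
    (f : (ι → I) → ℝ) (x : ι → I) :
    ∃ y : ι → I, (∀ i, |(y i : ℝ) - x i| < δ) ∧
      byPartsSum P ((Ici x).indicator 1) f = f y := by
  choose m hmn hm hmδ using fun i => P.exists_ceil hδ hP i (x i)
  refine ⟨fun i => P.pts i (m i), hmδ, ?_⟩
  -- In each coordinate, δ_y is δ_1 minus the ladder steps above y. Expanding the product, L
  -- collects the coordinates in which the steps are chosen.
  have hy : ∀ i, pointMass (P.pts i (m i)) = pointMass 1 -
      ∑ j : Fin P.n, (if m i ≤ (j : ℕ) then (1 : ℝ) else 0) •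
        (pointMass (P.pts i (j + 1)) - pointMass (P.pts i j)) := fun i => by
    rw [sum_indicator_pointMass _ (hmn i), P.last]
    abel
  rw [← multiEval_pointMass f]
  simp only [hy]
  rw [map_sub_univ, byPartsSum]
  refine Finset.sum_congr rfl fun L _ => ?_
  congr 1
  have h1 : (fun i => if i ∈ L then ∑ j : Fin P.n, (if m i ≤ (j : ℕ) then (1 : ℝ) else 0) •
        (pointMass (P.pts i (j + 1)) - pointMass (P.pts i j)) else pointMass 1) =
      fun i => if hi : i ∈ L then (fun i : L => ∑ j : Fin P.n,
        (if m i ≤ (j : ℕ) then (1 : ℝ) else 0) •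
        (pointMass (P.pts i (j + 1)) - pointMass (P.pts i j))) ⟨i, hi⟩ else pointMass 1 := by
    ext1 i
    by_cases hi : i ∈ L <;> simp [hi]
  rw [h1, ← multiEval_margin L f (fun i : L => ∑ j : Fin P.n,
        (if m i ≤ (j : ℕ) then (1 : ℝ) else 0) •
        (pointMass (P.pts i (j + 1)) - pointMass (P.pts i j))), MultilinearMap.map_sum]
  refine Finset.sum_congr rfl fun k _ => ?_
  rw [MultilinearMap.map_smul_univ, boxIncrement_eq_multiEval, smul_eq_mul]
  congr 1
  -- The indicator of [x,1] at a lower corner is the product of the coordinate indicators;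
  -- coordinates outside L are 1 and impose nothing.
  have hiff : (fun i => if hi : i ∈ L then (P.restrict L).lower k ⟨i, hi⟩ else 1) ∈ Ici x ↔
      ∀ i : L, m i ≤ (k i : ℕ) := by
    constructor
    · intro h i
      have := h i
      simp only [Finset.coe_mem, dite_true] at this
      exact (hm i _).1 this
    · intro h i
      by_cases hi : i ∈ L
      · simp only [hi, dite_true]
        exact (hm i _).2 (h ⟨i, hi⟩)
      · simpa only [hi, dite_false] using unitInterval.le_one'
  by_cases h : ∀ i : L, m i ≤ (k i : ℕ)
  · rw [margin, indicator_of_mem (hiff.2 h)]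
    simp [h]
  · rw [margin, indicator_of_notMem (hiff.not.2 h)]
    obtain ⟨i, hi⟩ := not_forall.1 h
    exact (Finset.prod_eq_zero (Finset.mem_univ i) (if_neg hi)).symm

/-! ### Existence of Stieltjes integrals -/

/-- The box is [c,d] clamped into [a,b]. If the two do not overlap in coordinate i, clamping
collapses that side to a point. -/
theorem boxIncrement_clamp_eq_zero (g : (ι → I) → ℝ) {a b c d : ι → I} (hab : a ≤ b) (hcd : c ≤ d)
    (i : ι) (h : b i ≤ c i ∨ d i ≤ a i) :
    boxIncrement g (a ⊔ (b ⊓ c)) (a ⊔ (b ⊓ d)) = 0 := by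
  refine boxIncrement_eq_zero g i ?_
  have h1 := hab i
  have h2 := hcd i
  simp only [Pi.sup_apply, Pi.inf_apply]
  rcases h with h | h
  · rw [inf_eq_left.2 h, inf_eq_left.2 (h.trans h2)]
  · rw [inf_eq_right.2 ((h2.trans h).trans h1), inf_eq_right.2 (h.trans h1), sup_eq_left.2 h,
      sup_eq_left.2 (h2.trans h)]

/-- For disjoint boxes the two clampings differ, but both increments vanish; for overlapping ones
both give the intersection. -/
theorem boxIncrement_clamp_comm (g : (ι → I) → ℝ) {a b c d : ι → I} (hab : a ≤ b) (hcd : c ≤ d) :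
    boxIncrement g (a ⊔ (b ⊓ c)) (a ⊔ (b ⊓ d)) = boxIncrement g (c ⊔ (d ⊓ a)) (c ⊔ (d ⊓ b)) := by
  by_cases h : ∃ i, b i ≤ c i ∨ d i ≤ a i
  · obtain ⟨i, hi⟩ := h
    rw [boxIncrement_clamp_eq_zero g hab hcd i hi, boxIncrement_clamp_eq_zero g hcd hab i hi.symm]
  · push Not at h
    congr 1 <;> ext1 i <;> obtain ⟨h1, h2⟩ := h i <;> have h3 := hab i <;> have h4 := hcd i <;>
      simp only [Pi.sup_apply, Pi.inf_apply]
    · rw [inf_eq_right.2 h1.le, inf_eq_right.2 h2.le, sup_comm]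
    · rw [inf_comm (d i), sup_eq_right.2 (le_inf h3 h2.le), sup_eq_right.2 (le_inf h1.le h4)]

omit [Fintype ι] [DecidableEq ι] in
theorem Grid.lower_le_upper (P : Grid ι) (k : ι → Fin P.n) : P.lower k ≤ P.upper k :=
  fun i => P.mono i (Nat.le_succ _)

/-- The increment of `g` over the intersection of two grid cells. -/
def overlapIncrement (g : (ι → I) → ℝ) (P Q : Grid ι) (k : ι → Fin P.n) (l : ι → Fin Q.n) : ℝ :=
  boxIncrement g (P.lower k ⊔ (P.upper k ⊓ Q.lower l)) (P.lower k ⊔ (P.upper k ⊓ Q.upper l))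

theorem overlapIncrement_comm (g : (ι → I) → ℝ) (P Q : Grid ι) (k : ι → Fin P.n)
    (l : ι → Fin Q.n) : overlapIncrement g P Q k l = overlapIncrement g Q P l k :=
  boxIncrement_clamp_comm g (P.lower_le_upper k) (Q.lower_le_upper l)

/-- The ladders of Q, clamped to a cell of P, subdivide that cell. -/
theorem sum_overlapIncrement (g : (ι → I) → ℝ) (P Q : Grid ι) (k : ι → Fin P.n) :
    ∑ l, overlapIncrement g P Q k l = boxIncrement g (P.lower k) (P.upper k) := by
  have h := sum_boxIncrement g Q.n (fun i j => P.lower k i ⊔ (P.upper k i ⊓ Q.pts i j))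
  refine (Finset.sum_congr rfl fun l _ => rfl).trans (h.trans ?_)
  congr 1 <;> ext1 i
  · rw [Q.first, inf_eq_right.2 unitInterval.nonneg', sup_eq_left.2 unitInterval.nonneg']
  · rw [Q.last, inf_eq_left.2 unitInterval.le_one', sup_eq_right.2 (P.lower_le_upper k i)]

/-- A common refinement of two grids. -/
def Grid.refine (P Q : Grid ι) : Grid ι where
  n := P.n * Q.n
  -- The index j encodes the cell j / Q.n of P and the step j % Q.n of Q clamped to it.
  pts i j := P.pts i (j / Q.n) ⊔ (P.pts i (j / Q.n + 1) ⊓ Q.pts i (j % Q.n))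
  mono i j j' hj := by
    rcases (Nat.div_le_div_right (c := Q.n) hj).eq_or_lt with h | h
    · have hmod : j % Q.n ≤ j' % Q.n := by
        have h1 := Nat.div_add_mod j Q.n
        have h2 := Nat.div_add_mod j' Q.n
        rw [h] at h1
        omega
      simp only [h]
      exact sup_le_sup_left (inf_le_inf_left _ (Q.mono i hmod)) _
    · calc P.pts i (j / Q.n) ⊔ (P.pts i (j / Q.n + 1) ⊓ Q.pts i (j % Q.n))
          ≤ P.pts i (j / Q.n + 1) := sup_le (P.mono i (Nat.le_succ _)) inf_le_left
        _ ≤ P.pts i (j' / Q.n) := P.mono i h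
        _ ≤ _ := le_sup_left
  first i := by
    rw [Nat.zero_div, Nat.zero_mod, P.first, Q.first, inf_eq_right.2 unitInterval.nonneg',
      sup_idem]
  last i := by
    rcases Nat.eq_zero_or_pos Q.n with h | h
    · have h0 := Q.first i
      rw [← h, Q.last i] at h0
      exact absurd h0 one_ne_zero
    · rw [Nat.mul_div_cancel _ h, P.last]
      exact sup_eq_left.2 unitInterval.le_one'

/-- Overlaps are the cells of one grid, so the Vitali bound applies to their double sum. -/
theorem sum_abs_overlapIncrement (g : (ι → I) → ℝ) (P Q : Grid ι) :
    ∑ k, ∑ l, |overlapIncrement g P Q k l| =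
      ∑ r : ι → Fin (P.refine Q).n,
        |boxIncrement g ((P.refine Q).lower r) ((P.refine Q).upper r)| := by
  rw [← Fintype.sum_prod_type']
  refine Fintype.sum_equiv ((Equiv.arrowProdEquivProdArrow ι (fun _ => Fin P.n)
    (fun _ => Fin Q.n)).symm.trans (Equiv.piCongrRight fun _ => finProdFinEquiv)) _ _ ?_
  rintro ⟨k, l⟩
  have hQ : ∀ i, 0 < Q.n := fun i => (Nat.zero_le _).trans_lt (l i).2
  have hval : ∀ i, ((((Equiv.arrowProdEquivProdArrow ι (fun _ => Fin P.n)
      (fun _ => Fin Q.n)).symm.trans (Equiv.piCongrRight fun _ => finProdFinEquiv)) (k, l) i :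
      Fin (P.n * Q.n)) : ℕ) = l i + Q.n * k i := fun i => rfl
  rw [overlapIncrement]
  congr 2 <;> ext1 i
  · simp only [Grid.lower, Grid.upper, Grid.refine, Pi.sup_apply, Pi.inf_apply]
    rw [hval, Nat.add_mul_div_left _ _ (hQ i), Nat.div_eq_of_lt (l i).2, zero_add,
      Nat.add_mul_mod_self_left, Nat.mod_eq_of_lt (l i).2]
  · simp only [Grid.lower, Grid.upper, Grid.refine, Pi.sup_apply, Pi.inf_apply]
    rw [hval, show (l i : ℕ) + Q.n * k i + 1 = l i + 1 + Q.n * k i by ring,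
      Nat.add_mul_div_left _ _ (hQ i), Nat.add_mul_mod_self_left]
    -- At the last step of Q the index carries into the next cell of P, whose lower end is the upper
    -- end of this one.
    rcases (Nat.succ_le_of_lt (l i).2).eq_or_lt with h | h
    · rw [Nat.succ_eq_add_one] at h
      rw [h, Nat.div_self (hQ i), Nat.mod_self, Q.last, Q.first,
        inf_eq_left.2 unitInterval.le_one', inf_eq_right.2 unitInterval.nonneg',
        sup_eq_left.2 unitInterval.nonneg', add_comm 1]
      exact sup_eq_right.2 (P.mono i (Nat.le_succ _))
    · rw [Nat.div_eq_of_lt h, zero_add, Nat.mod_eq_of_lt h]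

/-- A Riemann-Stieltjes sum. -/
def stieltjesSum (f g : (ι → I) → ℝ) (P : Grid ι) (ξ : (ι → Fin P.n) → ι → I) : ℝ :=
  ∑ k, f (ξ k) * boxIncrement g (P.lower k) (P.upper k)

theorem stieltjesSum_sub_stieltjesSum (f g : (ι → I) → ℝ) (P Q : Grid ι)
    (ξ : (ι → Fin P.n) → ι → I) (η : (ι → Fin Q.n) → ι → I) :
    stieltjesSum f g P ξ - stieltjesSum f g Q η =
      ∑ k, ∑ l, (f (ξ k) - f (η l)) * overlapIncrement g P Q k l := by
  have h1 : stieltjesSum f g P ξ = ∑ k, ∑ l, f (ξ k) * overlapIncrement g P Q k l := by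
    simp only [stieltjesSum, ← Finset.mul_sum, sum_overlapIncrement]
  have h2 : stieltjesSum f g Q η = ∑ k, ∑ l, f (η l) * overlapIncrement g P Q k l := by
    rw [Finset.sum_comm]
    simp only [stieltjesSum, overlapIncrement_comm g P Q, ← Finset.mul_sum, sum_overlapIncrement]
  simp only [h1, h2, sub_mul, Finset.sum_sub_distrib]

/-- Compare the sums on overlaps: tags of overlapping cells are within 2δ in each coordinate, and
other pairs contribute 0. -/
theorem abs_stieltjesSum_sub_le {f g : (ι → I) → ℝ} {M : ℝ}
    (hM : ∀ P : Grid ι, ∑ k : ι → Fin P.n, |boxIncrement g (P.lower k) (P.upper k)| ≤ M)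
    {δ ε : ℝ} (hε : 0 ≤ ε)
    (hf : ∀ x y : ι → I, (∀ i, |(x i : ℝ) - y i| < 2 * δ) → |f x - f y| ≤ ε) {P Q : Grid ι}
    (hP : P.MeshLT δ) (hQ : Q.MeshLT δ)
    {ξ : (ι → Fin P.n) → ι → I} {η : (ι → Fin Q.n) → ι → I}
    (hξ : ∀ k, ξ k ∈ Icc (P.lower k) (P.upper k)) (hη : ∀ l, η l ∈ Icc (Q.lower l) (Q.upper l)) :
    |stieltjesSum f g P ξ - stieltjesSum f g Q η| ≤ ε * M := by
  rw [stieltjesSum_sub_stieltjesSum]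
  calc _ ≤ ∑ k, ∑ l, ε * |overlapIncrement g P Q k l| := by
        refine (Finset.abs_sum_le_sum_abs _ _).trans (Finset.sum_le_sum fun k _ =>
          (Finset.abs_sum_le_sum_abs _ _).trans (Finset.sum_le_sum fun l _ => ?_))
        by_cases h : ∃ i, P.upper k i ≤ Q.lower l i ∨ Q.upper l i ≤ P.lower k i
        · obtain ⟨i, hi⟩ := h
          rw [overlapIncrement, boxIncrement_clamp_eq_zero g (P.lower_le_upper k)
            (Q.lower_le_upper l) i hi]
          simp
        · push Not at h
          rw [abs_mul]
          refine mul_le_mul_of_nonneg_right (hf _ _ fun i => ?_) (abs_nonneg _)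
          obtain ⟨h1, h2⟩ := h i
          have h3 : (P.lower k i : ℝ) ≤ ξ k i := (hξ k).1 i
          have h4 : (ξ k i : ℝ) ≤ P.upper k i := (hξ k).2 i
          have h5 : (Q.lower l i : ℝ) ≤ η l i := (hη l).1 i
          have h6 : (η l i : ℝ) ≤ Q.upper l i := (hη l).2 i
          have h7 : (P.upper k i : ℝ) - P.lower k i < δ := hP i _ (k i).2
          have h8 : (Q.upper l i : ℝ) - Q.lower l i < δ := hQ i _ (l i).2
          have h1' : (Q.lower l i : ℝ) < P.upper k i := h1
          have h2' : (P.lower k i : ℝ) < Q.upper l i := h2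
          rw [abs_lt]
          constructor <;> linarith
    _ = ε * ∑ k, ∑ l, |overlapIncrement g P Q k l| := by simp only [Finset.mul_sum]
    _ ≤ ε * M := by
        rw [sum_abs_overlapIncrement]
        exact mul_le_mul_of_nonneg_left (hM _) hε

omit [DecidableEq ι] in
theorem exists_modulus {f : (ι → I) → ℝ} (hf : Continuous f) {ε : ℝ} (hε : 0 < ε) :
    ∃ δ > 0, ∀ x y : ι → I, (∀ i, |(x i : ℝ) - y i| < δ) → |f x - f y| ≤ ε := by
  obtain ⟨δ, hδ, h⟩ := Metric.uniformContinuous_iff.1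
    (CompactSpace.uniformContinuous_of_continuous hf) ε hε
  refine ⟨δ, hδ, fun x y hxy => ?_⟩
  have h1 : dist x y < δ := (dist_pi_lt_iff hδ).2 fun i => by
    rw [Subtype.dist_eq, Real.dist_eq]
    exact hxy i
  have := h h1
  rw [Real.dist_eq] at this
  exact this.le

/-- The grid with `N + 1` cells of equal length in each coordinate. -/
def uniformGrid (ι : Type*) (N : ℕ) : Grid ι where
  n := N + 1
  pts _ j := projIcc 0 1 zero_le_one ((j : ℝ) / (N + 1))
  mono _ := (monotone_projIcc _).comp fun j j' h => by
    have : (j : ℝ) ≤ j' := by exact_mod_cast h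
    show (j : ℝ) / (N + 1) ≤ j' / (N + 1)
    gcongr
  first _ := by simp
  last _ := by
    have : ((N : ℝ) + 1) ≠ 0 := by positivity
    simp [div_self this]

omit [Fintype ι] [DecidableEq ι] in
theorem eventually_meshLT_uniformGrid {δ : ℝ} (hδ : 0 < δ) :
    ∀ᶠ N in atTop, (uniformGrid ι N).MeshLT δ := by
  have h := (tendsto_one_div_add_atTop_nhds_zero_nat (𝕜 := ℝ)).eventually (gt_mem_nhds hδ)
  filter_upwards [h] with N hN i j hj
  have hN' : (0 : ℝ) < N + 1 := by positivity
  have hj' : (j : ℝ) + 1 ≤ N + 1 := by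
    have : j + 1 ≤ N + 1 := hj
    exact_mod_cast this
  have h1 : ((j + 1 : ℕ) : ℝ) / (N + 1) ∈ Icc (0 : ℝ) 1 :=
    ⟨by positivity, by push_cast; rw [div_le_one hN']; exact hj'⟩
  have h2 : ((j : ℕ) : ℝ) / (N + 1) ∈ Icc (0 : ℝ) 1 :=
    ⟨by positivity, by rw [div_le_one hN']; linarith⟩
  simp only [uniformGrid]
  rw [projIcc_of_mem _ h1, projIcc_of_mem _ h2]
  push_cast
  rw [← sub_div, add_sub_cancel_left]
  exact hN

/-- A continuous function has a Stieltjes integral with respect to a function of bounded Vitali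
variation. -/
theorem exists_hasStieltjesIntegral {f g : (ι → I) → ℝ} (hf : Continuous f) (hg : IsVitaliBV g) :
    ∃ J, HasStieltjesIntegral f g J := by
  obtain ⟨M, hM⟩ := hg
  have hM0 : 0 ≤ M := (Finset.sum_nonneg fun _ _ => abs_nonneg _).trans (hM (uniformGrid ι 0))
  have key : ∀ ε > 0, ∃ δ > 0, ∀ (P Q : Grid ι) (ξ : (ι → Fin P.n) → ι → I)
      (η : (ι → Fin Q.n) → ι → I), P.MeshLT δ → Q.MeshLT δ →
      (∀ k, ξ k ∈ Icc (P.lower k) (P.upper k)) → (∀ l, η l ∈ Icc (Q.lower l) (Q.upper l)) →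
      |stieltjesSum f g P ξ - stieltjesSum f g Q η| < ε := by
    intro ε hε
    obtain ⟨δ, hδ, h⟩ := exists_modulus hf (ε := ε / (M + 1)) (by positivity)
    refine ⟨δ / 2, by positivity, fun P Q ξ η hP hQ hξ hη => ?_⟩
    refine (abs_stieltjesSum_sub_le (ε := ε / (M + 1)) hM (by positivity)
      (by rwa [mul_div_cancel₀ _ two_ne_zero]) hP hQ hξ hη).trans_lt ?_
    rw [div_mul_eq_mul_div, div_lt_iff₀ (by positivity)]
    linarith
  have hlow : ∀ (P : Grid ι) (k : ι → Fin P.n), P.lower k ∈ Icc (P.lower k) (P.upper k) :=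
    fun P k => ⟨le_rfl, P.lower_le_upper k⟩
  have hcau : CauchySeq fun N =>
      stieltjesSum f g (uniformGrid ι N) (uniformGrid ι N).lower := by
    refine Metric.cauchySeq_iff.2 fun ε hε => ?_
    obtain ⟨δ, hδ, h⟩ := key ε hε
    obtain ⟨N, hN⟩ := eventually_atTop.1 (eventually_meshLT_uniformGrid (ι := ι) hδ)
    exact ⟨N, fun m hm n hn => h _ _ _ _ (hN m hm) (hN n hn) (hlow _) (hlow _)⟩
  obtain ⟨J, hJ⟩ := cauchySeq_tendsto_of_complete hcau
  refine ⟨J, fun ε hε => ?_⟩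
  obtain ⟨δ, hδ, h⟩ := key (ε / 2) (by positivity)
  refine ⟨δ, hδ, fun P ξ hξ hP => ?_⟩
  have hP' : P.MeshLT δ := fun i j hj => hP (fun _ => ⟨j, hj⟩) i
  have hlim : Tendsto (fun N => |stieltjesSum f g P ξ -
      stieltjesSum f g (uniformGrid ι N) (uniformGrid ι N).lower|) atTop
      (𝓝 |stieltjesSum f g P ξ - J|) := (tendsto_const_nhds.sub hJ).abs
  have hle : |stieltjesSum f g P ξ - J| ≤ ε / 2 := by
    refine le_of_tendsto hlim ?_
    filter_upwards [eventually_meshLT_uniformGrid (ι := ι) hδ] with N hN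
    exact (h _ _ _ _ hP' hN hξ (hlow _)).le
  exact lt_of_le_of_lt hle (by linarith)

/-! ### Margins -/

/-- The point of the cube with coordinates `v` in `K`, and `1` outside `K`. -/
def extendOne {ι : Type*} [DecidableEq ι] (K : Finset ι) (v : K → I) : ι → I :=
  fun i => if hi : i ∈ K then v ⟨i, hi⟩ else 1

omit [Fintype ι] in
theorem continuous_extendOne (K : Finset ι) : Continuous (extendOne K) := by
  refine continuous_pi fun i => ?_
  by_cases hi : i ∈ K
  · simpa only [extendOne, hi, dite_true] using continuous_apply (⟨i, hi⟩ : K)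
  · simpa only [extendOne, hi, dite_false] using continuous_const

omit [Fintype ι] in
theorem margin_eq_comp (K : Finset ι) (F : (ι → I) → ℝ) : margin K F = F ∘ extendOne K := rfl

omit [Fintype ι] in
theorem le_extendOne_iff (K : Finset ι) (x : ι → I) (v : K → I) :
    x ≤ extendOne K v ↔ (fun i : K => x i) ≤ v := by
  constructor
  · intro h i
    simpa only [extendOne, Finset.coe_mem, dite_true] using h i
  · intro h i
    by_cases hi : i ∈ K
    · simpa only [extendOne, hi, dite_true] using h ⟨i, hi⟩
    · simpa only [extendOne, hi, dite_false] using unitInterval.le_one'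

/-! ### Integration by parts -/

theorem byPartsSum_sub (P : Grid ι) (h h' f : (ι → I) → ℝ) :
    byPartsSum P (h - h') f = byPartsSum P h f - byPartsSum P h' f := by
  simp only [byPartsSum, margin_eq_comp, Function.comp_apply, Pi.sub_apply, sub_mul,
    Finset.sum_sub_distrib, mul_sub]

theorem byPartsSum_add (P : Grid ι) (h h' f : (ι → I) → ℝ) :
    byPartsSum P (h + h') f = byPartsSum P h f + byPartsSum P h' f := by
  simp only [byPartsSum, margin_eq_comp, Function.comp_apply, Pi.add_apply, add_mul,
    Finset.sum_add_distrib, mul_add]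

theorem byPartsSum_smul (P : Grid ι) (c : ℝ) (h f : (ι → I) → ℝ) :
    byPartsSum P (c • h) f = c * byPartsSum P h f := by
  simp only [byPartsSum, margin_eq_comp, Function.comp_apply, Pi.smul_apply, smul_eq_mul,
    Finset.mul_sum]
  refine Finset.sum_congr rfl fun L _ => Finset.sum_congr rfl fun k _ => ?_
  ring

-- The case L = ∅ lies outside the Hardy-Krause condition, but there the only cell is a point with
-- increment f(1).
omit [Fintype ι] in
theorem IsHardyKrauseBV.isVitaliBV_margin {f : (ι → I) → ℝ} (hf : IsHardyKrauseBV f)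
    (L : Finset ι) : IsVitaliBV (margin L f) := by
  rcases L.eq_empty_or_nonempty with rfl | hL
  · refine ⟨|f 1|, fun P => ?_⟩
    simp [boxIncrement, margin, Pi.one_def]
  · exact hf L hL

/-- V adds up the Vitali bounds of all faces, hence does not depend on the grid. -/
theorem IsHardyKrauseBV.exists_abs_byPartsSum_le {f : (ι → I) → ℝ} (hf : IsHardyKrauseBV f) :
    ∃ V : ℝ, ∀ (P : Grid ι) (h : (ι → I) → ℝ) (c : ℝ), (∀ u, |h u| ≤ c) →
      |byPartsSum P h f| ≤ c * V := by
  choose M hM using hf.isVitaliBV_margin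
  refine ⟨∑ L, M L, fun P h c hc => ?_⟩
  have hc0 : 0 ≤ c := (abs_nonneg _).trans (hc 1)
  rw [byPartsSum, Finset.mul_sum]
  refine (Finset.abs_sum_le_sum_abs _ _).trans (Finset.sum_le_sum fun L _ => ?_)
  rw [abs_mul, abs_pow, abs_neg, abs_one, one_pow, one_mul]
  calc _ ≤ ∑ k : L → Fin (P.restrict L).n, c *
        |boxIncrement (margin L f) ((P.restrict L).lower k) ((P.restrict L).upper k)| := by
        refine (Finset.abs_sum_le_sum_abs _ _).trans (Finset.sum_le_sum fun k _ => ?_)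
        rw [abs_mul]
        exact mul_le_mul_of_nonneg_right (hc _) (abs_nonneg _)
    _ ≤ c * M L := by
        rw [← Finset.mul_sum]
        exact mul_le_mul_of_nonneg_left (hM L _) hc0

theorem exists_hasIntegralByParts {f h : (ι → I) → ℝ} (hf : IsHardyKrauseBV f)
    (hh : Continuous h) : ∃ J, HasIntegralByParts f h J := by
  choose T hT using fun L : Finset ι => exists_hasStieltjesIntegral
    (f := margin L h) (hh.comp (continuous_extendOne L)) (hf.isVitaliBV_margin L)
  exact ⟨_, T, hT, rfl⟩

theorem HasStieltjesIntegral.tendsto {f g : (ι → I) → ℝ} {J : ℝ}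
    (hJ : HasStieltjesIntegral f g J) :
    Tendsto (fun N => stieltjesSum f g (uniformGrid ι N) (uniformGrid ι N).lower) atTop (𝓝 J) := by
  refine Metric.tendsto_atTop'.2 fun ε hε => ?_
  obtain ⟨δ, hδ, h⟩ := hJ ε hε
  obtain ⟨N, hN⟩ := eventually_atTop.1 (eventually_meshLT_uniformGrid (ι := ι) hδ)
  exact ⟨N, fun n hn => h _ _ (fun k => ⟨le_rfl, Grid.lower_le_upper _ k⟩)
    fun k i => hN n hn.le i _ (k i).2⟩

/-- Makes J unique and carries identities and bounds from finite sums to J. Uniform grids restrict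
to uniform grids on faces. -/
theorem HasIntegralByParts.tendsto {f h : (ι → I) → ℝ} {J : ℝ} (hJ : HasIntegralByParts f h J) :
    Tendsto (fun N => byPartsSum (uniformGrid ι N) h f) atTop (𝓝 J) := by
  obtain ⟨T, hT, rfl⟩ := hJ
  exact tendsto_finsetSum _ fun L _ => (hT L).tendsto.const_mul _

/-- The integral by parts, as a continuous linear functional. -/
theorem exists_integralByParts_clm {X : Type*} [TopologicalSpace X] [CompactSpace X]
    {f : (ι → I) → ℝ} (hf : IsHardyKrauseBV f) {m : (ι → I) → X} (hm : Continuous m) :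
    ∃ D : C(X, ℝ) →L[ℝ] ℝ, ∀ h : C(X, ℝ), HasIntegralByParts f (h ∘ m) (D h) := by
  choose D hD using fun h : C(X, ℝ) => exists_hasIntegralByParts hf (h.continuous.comp hm)
  obtain ⟨V, hV⟩ := hf.exists_abs_byPartsSum_le
  refine ⟨LinearMap.mkContinuous ⟨⟨D, fun h h' => ?_⟩, fun c h => ?_⟩ V fun h => ?_, hD⟩
  · refine tendsto_nhds_unique (hD (h + h')).tendsto ?_
    refine ((hD h).tendsto.add (hD h').tendsto).congr fun N => ?_
    rw [← byPartsSum_add]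
    rfl
  · refine tendsto_nhds_unique (hD (c • h)).tendsto ?_
    refine ((hD h).tendsto.const_mul c).congr fun N => ?_
    rw [← byPartsSum_smul]
    rfl
  · refine le_of_tendsto (hD h).tendsto.abs (Eventually.of_forall fun N => ?_)
    rw [mul_comm]
    exact hV _ _ _ fun u => h.norm_coe_le_norm _

/-! ### By-parts sums of distribution functions of measures -/

omit [DecidableEq ι] in
theorem measurable_indicator_Ici (u : ι → I) :
    Measurable fun x : ι → I => (Ici x).indicator (1 : (ι → I) → ℝ) u := by
  have h : (fun x : ι → I => (Ici x).indicator (1 : (ι → I) → ℝ) u) = (Iic u).indicator 1 := by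
    ext x
    by_cases hx : x ≤ u <;> simp [indicator, hx]
  rw [h]
  exact measurable_one.indicator measurableSet_Iic

omit [DecidableEq ι] in
theorem integral_indicator_Ici (μ : Measure (ι → I)) (u : ι → I) :
    ∫ x, (Ici x).indicator (1 : (ι → I) → ℝ) u ∂μ = μ.real (Iic u) := by
  have h : (fun x : ι → I => (Ici x).indicator (1 : (ι → I) → ℝ) u) = (Iic u).indicator 1 := by
    ext x
    by_cases hx : x ≤ u <;> simp [indicator, hx]
  rw [h, integral_indicator_one measurableSet_Iic]

omit [DecidableEq ι] in
theorem integrable_indicator_Ici (μ : Measure (ι → I)) [IsFiniteMeasure μ] (u : ι → I) :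
    Integrable (fun x => (Ici x).indicator (1 : (ι → I) → ℝ) u) μ := by
  refine Integrable.of_bound (measurable_indicator_Ici u).aestronglyMeasurable 1
    (Eventually.of_forall fun x => ?_)
  by_cases hx : x ≤ u <;> simp [indicator, hx]

theorem integrable_byPartsSum_indicator (P : Grid ι) (f : (ι → I) → ℝ) (μ : Measure (ι → I))
    [IsFiniteMeasure μ] : Integrable (fun x => byPartsSum P ((Ici x).indicator 1) f) μ :=
  integrable_finsetSum _ fun _ _ => (integrable_finsetSum _ fun _ _ =>
    (integrable_indicator_Ici μ _).mul_const _).const_mul _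

/-- A cdf is the μ-mixture of the indicators of [x,1], and the by-parts sum is linear with finitely
many terms. -/
theorem integral_byPartsSum_indicator (P : Grid ι) (f : (ι → I) → ℝ) (μ : Measure (ι → I))
    [IsFiniteMeasure μ] :
    ∫ x, byPartsSum P ((Ici x).indicator 1) f ∂μ = byPartsSum P (fun u => μ.real (Iic u)) f := by
  simp only [byPartsSum, margin_eq_comp, Function.comp_apply]
  rw [integral_finsetSum _ fun _ _ => (integrable_finsetSum _ fun _ _ =>
    (integrable_indicator_Ici μ _).mul_const _).const_mul _]
  refine Finset.sum_congr rfl fun L _ => ?_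
  rw [integral_const_mul, integral_finsetSum _ fun _ _ =>
    (integrable_indicator_Ici μ _).mul_const _]
  congr 1
  refine Finset.sum_congr rfl fun k _ => ?_
  rw [integral_mul_const]
  congr 1
  exact integral_indicator_Ici μ _

omit [DecidableEq ι] in
theorem integrable_of_continuous {f : (ι → I) → ℝ} (hf : Continuous f) (μ : Measure (ι → I))
    [IsFiniteMeasure μ] : Integrable f μ := by
  rw [← integrableOn_univ]
  exact hf.continuousOn.integrableOn_compact isCompact_univ

/-- Approximate integration by parts on a fine grid. -/
theorem abs_integral_sub_byPartsSum_le {f : (ι → I) → ℝ} (hf : Continuous f) {δ ε : ℝ}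
    (hδ : 0 < δ) (hfδ : ∀ x y : ι → I, (∀ i, |(x i : ℝ) - y i| < δ) → |f x - f y| ≤ ε)
    {P : Grid ι} (hP : P.MeshLT δ) (μ : Measure (ι → I)) [IsFiniteMeasure μ] :
    |∫ x, f x ∂μ - byPartsSum P (fun u => μ.real (Iic u)) f| ≤ ε * μ.real univ := by
  rw [← integral_byPartsSum_indicator, ← integral_sub (integrable_of_continuous hf μ)
    (integrable_byPartsSum_indicator P f μ), ← Real.norm_eq_abs]
  refine norm_integral_le_of_norm_le_const (Eventually.of_forall fun x => ?_)
  obtain ⟨y, hy, hfy⟩ := exists_byPartsSum_indicator P hδ hP f x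
  rw [hfy, Real.norm_eq_abs, abs_sub_comm]
  exact hfδ _ _ hy

theorem tendsto_byPartsSum_measure {f : (ι → I) → ℝ} (hf : Continuous f) (μ : Measure (ι → I))
    [IsFiniteMeasure μ] :
    Tendsto (fun N => byPartsSum (uniformGrid ι N) (fun u => μ.real (Iic u)) f) atTop
      (𝓝 (∫ x, f x ∂μ)) := by
  refine Metric.tendsto_atTop.2 fun ε hε => ?_
  obtain ⟨δ, hδ, h⟩ := exists_modulus hf (ε := ε / (μ.real univ + 1)) (by positivity)
  obtain ⟨N, hN⟩ := eventually_atTop.1 (eventually_meshLT_uniformGrid (ι := ι) hδ)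
  refine ⟨N, fun n hn => ?_⟩
  rw [dist_comm, Real.dist_eq]
  refine (abs_integral_sub_byPartsSum_le hf hδ h (hN n hn) μ).trans_lt ?_
  rw [div_mul_eq_mul_div, div_lt_iff₀ (by positivity)]
  linarith

/-- Stability of integration by parts. -/
theorem abs_integral_sub_integral_sub_le {f h : (ι → I) → ℝ} (hf : Continuous f) {V : ℝ}
    (hV : ∀ (P : Grid ι) (h : (ι → I) → ℝ) (c : ℝ), (∀ u, |h u| ≤ c) →
      |byPartsSum P h f| ≤ c * V) {J : ℝ} (hJ : HasIntegralByParts f h J)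
    (μ₁ μ₂ : Measure (ι → I)) [IsFiniteMeasure μ₁] [IsFiniteMeasure μ₂] {t c : ℝ}
    (hc : ∀ v, |μ₁.real (Iic v) - μ₂.real (Iic v) - t * h v| ≤ c) :
    |∫ x, f x ∂μ₁ - ∫ x, f x ∂μ₂ - t * J| ≤ c * V := by
  refine le_of_tendsto (((tendsto_byPartsSum_measure hf μ₁).sub
    (tendsto_byPartsSum_measure hf μ₂)).sub (hJ.tendsto.const_mul t)).abs
    (Eventually.of_forall fun N => ?_)
  rw [← byPartsSum_smul, ← byPartsSum_sub, ← byPartsSum_sub]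
  exact hV _ _ _ hc

/-- Convergence of distribution functions implies weak convergence. -/
theorem tendsto_integral_of_tendsto_cdf {f : (ι → I) → ℝ} (hf : Continuous f)
    {μs : ℕ → Measure (ι → I)} {μ : Measure (ι → I)} [∀ n, IsProbabilityMeasure (μs n)]
    [IsProbabilityMeasure μ]
    (h : ∀ u, Tendsto (fun n => (μs n).real (Iic u)) atTop (𝓝 (μ.real (Iic u)))) :
    Tendsto (fun n => ∫ x, f x ∂(μs n)) atTop (𝓝 (∫ x, f x ∂μ)) := by
  refine Metric.tendsto_nhds.2 fun ε hε => ?_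
  obtain ⟨δ, hδ, hfδ⟩ := exists_modulus hf (ε := ε / 3) (by positivity)
  obtain ⟨N, hN⟩ := (eventually_meshLT_uniformGrid (ι := ι) hδ).exists
  -- On a fixed grid only finitely many values of the cdf enter, so pointwise convergence suffices
  -- and f needs no bounded variation.
  have hlim : Tendsto (fun n => byPartsSum (uniformGrid ι N) (fun u => (μs n).real (Iic u)) f)
      atTop (𝓝 (byPartsSum (uniformGrid ι N) (fun u => μ.real (Iic u)) f)) :=
    tendsto_finsetSum _ fun L _ => (tendsto_finsetSum _ fun k _ =>
      (h _).mul_const _).const_mul _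
  filter_upwards [Metric.tendsto_nhds.1 hlim (ε / 3) (by positivity)] with n hn
  have h1 := abs_integral_sub_byPartsSum_le hf hδ hfδ hN (μs n)
  have h2 := abs_integral_sub_byPartsSum_le hf hδ hfδ hN μ
  rw [probReal_univ, mul_one] at h1 h2
  rw [Real.dist_eq] at hn ⊢
  rw [abs_le] at h1 h2
  rw [abs_lt] at hn ⊢
  constructor <;> linarith [h1.1, h1.2, h2.1, h2.2, hn.1, hn.2]

/-! ### Distribution functions -/

-- F(u) is the measure of a section of the closed order relation.
omit [DecidableEq ι] in
theorem IsCdfOf.measurable {F : (ι → I) → ℝ} {μ : Measure (ι → I)} [IsProbabilityMeasure μ]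
    (hF : IsCdfOf F μ) : Measurable F := by
  have hs : MeasurableSet {q : (ι → I) × (ι → I) | q.2 ≤ q.1} :=
    measurableSet_le measurable_snd measurable_fst
  have h : F = fun u => (μ (Prod.mk u ⁻¹' {q : (ι → I) × (ι → I) | q.2 ≤ q.1})).toReal :=
    funext hF
  rw [h]
  exact (measurable_measure_prodMk_left hs).ennreal_toReal

omit [Fintype ι] [DecidableEq ι] in
theorem IsCdfOf.abs_le_one {F : (ι → I) → ℝ} {μ : Measure (ι → I)} [IsProbabilityMeasure μ]
    (hF : IsCdfOf F μ) (u : ι → I) : |F u| ≤ 1 := by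
  rw [hF, abs_of_nonneg measureReal_nonneg]
  exact measureReal_le_one

omit [Fintype ι] [DecidableEq ι] in
theorem IsCdfOf.apply_one {F : (ι → I) → ℝ} {μ : Measure (ι → I)} [IsProbabilityMeasure μ]
    (hF : IsCdfOf F μ) : F 1 = 1 := by
  have : Iic (1 : ι → I) = univ := eq_univ_of_forall fun x i => unitInterval.le_one'
  rw [hF, this, probReal_univ]

omit [Fintype ι] in
theorem margin_empty (F : (ι → I) → ℝ) : margin ∅ F = fun _ => F 1 := by
  ext v
  simp [margin, Pi.one_def]

/-- The margin is the cdf of the projected measure, so `cdfMeasure` does not take its default value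
0. -/
theorem isCdfOf_margin {F : (ι → I) → ℝ} (hF : F ∈ cdfs ι) (K : Finset ι) :
    IsProbabilityMeasure (cdfMeasure (margin K F)) ∧
      IsCdfOf (margin K F) (cdfMeasure (margin K F)) := by
  obtain ⟨μ, hμ, hFμ⟩ := hF
  have hm : Measurable fun (x : ι → I) (i : K) => x i :=
    measurable_pi_lambda _ fun i => measurable_pi_apply _
  have h1 : IsProbabilityMeasure (μ.map fun x (i : K) => x i) :=
    Measure.isProbabilityMeasure_map hm.aemeasurable
  have h2 : IsCdfOf (margin K F) (μ.map fun x (i : K) => x i) := fun v => by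
    rw [margin_eq_comp, Function.comp_apply, hFμ, map_measureReal_apply hm measurableSet_Iic]
    congr 1
    ext x
    exact le_extendOne_iff K x v
  rw [cdfMeasure_eq h1 h2]
  exact ⟨h1, h2⟩

/-- [0,u] minus [0,v] is covered by the strips v_i < x_i ≤ u_i, whose masses are known from the
uniform margins. -/
theorem IsCopula.sub_le {C : (ι → I) → ℝ} (hC : IsCopula C) (u v : ι → I) :
    C u - C v ≤ ∑ i, |(u i : ℝ) - v i| := by
  obtain ⟨⟨μ, hμ, hCμ⟩, hmar⟩ := hC
  have hIic : ∀ (i : ι) (s : I), Iic (Function.update (1 : ι → I) i s) = {x | x i ≤ s} := by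
    intro i s
    ext x
    simp only [mem_Iic, Set.mem_ofPred_eq]
    constructor
    · intro h
      simpa using h i
    · intro h j
      by_cases hj : j = i
      · subst hj
        simpa using h
      · simpa [hj] using unitInterval.le_one'
  have hsub : Iic u ⊆ Iic v ∪ ⋃ i ∈ Finset.univ, {x : ι → I | x i ≤ u i} \ {x | x i ≤ v i} := by
    intro x hx
    by_cases h : x ≤ v
    · exact Or.inl h
    · obtain ⟨i, hi⟩ := not_forall.1 h
      refine Or.inr (mem_iUnion₂.2 ⟨i, Finset.mem_univ i, hx i, hi⟩)
  have hstrip : ∀ i, μ.real ({x : ι → I | x i ≤ u i} \ {x | x i ≤ v i}) ≤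
      |(u i : ℝ) - v i| := by
    intro i
    have hms : ∀ s : I, MeasurableSet {x : ι → I | x i ≤ s} := fun s =>
      measurableSet_le (measurable_pi_apply i) measurable_const
    have hval : ∀ s : I, μ.real {x : ι → I | x i ≤ s} = s := fun s => by
      rw [← hIic, ← hCμ, hmar]
    rcases le_total (v i) (u i) with h | h
    · have hle : {x : ι → I | x i ≤ v i} ⊆ {x | x i ≤ u i} := fun x hx => le_trans hx h
      rw [measureReal_sdiff hle (hms _), hval, hval]
      exact le_abs_self _
    · have : ({x : ι → I | x i ≤ u i} \ {x | x i ≤ v i}) = ∅ :=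
        sdiff_eq_empty.2 fun x hx => le_trans hx h
      rw [this, measureReal_empty]
      exact abs_nonneg _
  have h1 := (measureReal_mono hsub (measure_ne_top μ _)).trans (measureReal_union_le _ _)
  have h2 := measureReal_biUnion_finset_le (μ := μ) Finset.univ
    fun i => {x : ι → I | x i ≤ u i} \ {x | x i ≤ v i}
  have h3 := Finset.sum_le_sum fun i (_ : i ∈ Finset.univ) => hstrip i
  rw [hCμ, hCμ]
  linarith

theorem IsCopula.continuous {C : (ι → I) → ℝ} (hC : IsCopula C) : Continuous C := by
  refine continuous_iff_continuousAt.2 fun v => ?_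
  have hlim : Tendsto (fun u : ι → I => ∑ i, |(u i : ℝ) - v i|) (𝓝 v) (𝓝 0) := by
    have hcont : Continuous fun u : ι → I => ∑ i, |(u i : ℝ) - v i| := by fun_prop
    simpa using hcont.tendsto v
  refine tendsto_iff_dist_tendsto_zero.2
    (squeeze_zero (fun _ => dist_nonneg) (fun u => ?_) hlim)
  rw [Real.dist_eq, abs_le]
  have h1 := hC.sub_le u v
  have h2 := hC.sub_le v u
  simp only [abs_sub_comm (v _ : ℝ)] at h2
  constructor <;> linarith

/-! ### The kernel `χ` -/

omit [Fintype ι] in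
theorem continuous_glue (K' : Finset ι) :
    Continuous fun q : (K' → I) × ({i // i ∉ K'} → I) => glue K' q.1 q.2 := by
  refine continuous_pi fun i => ?_
  by_cases hi : i ∈ K'
  · simp only [glue, hi, dite_true]
    exact (continuous_apply (⟨i, hi⟩ : K')).comp continuous_fst
  · simp only [glue, hi, dite_false]
    exact (continuous_apply (⟨i, hi⟩ : {i // i ∉ K'})).comp continuous_snd

/-- The point at which `χ` evaluates the function. -/
def chiPoint (K K' : Finset ι) (v : K' → I) (w : {i // i ∉ K'} → I) : ι → I :=
  extendOne K fun i => glue K' v w i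

theorem chi_eq (ψ : (ι → I) → ℝ) (K K' : Finset ι) (F : (ι → I) → ℝ) (v : K' → I) :
    chi ψ K K' F v = ∫ w, ψ (glue K' v w) * F (chiPoint K K' v w) := rfl

omit [Fintype ι] in
theorem continuous_chiPoint (K K' : Finset ι) :
    Continuous fun q : (K' → I) × ({i // i ∉ K'} → I) => chiPoint K K' q.1 q.2 :=
  (continuous_extendOne K).comp
    (continuous_pi fun i => (continuous_apply (i : ι)).comp (continuous_glue K'))

theorem continuous_chi {ψ : (ι → I) → ℝ} (hψ : Continuous ψ) (K K' : Finset ι)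
    {F : (ι → I) → ℝ} (hF : Continuous F) : Continuous (chi ψ K K' F) := by
  have h : Continuous (Function.uncurry fun (v : K' → I) (w : {i // i ∉ K'} → I) =>
      ψ (glue K' v w) * F (chiPoint K K' v w)) :=
    (hψ.comp (continuous_glue K')).mul (hF.comp (continuous_chiPoint K K'))
  have := continuous_parametric_integral_of_continuous
    (μ := (volume : Measure ({i // i ∉ K'} → I))) h isCompact_univ
  simp only [Measure.restrict_univ] at this
  exact this

omit [Fintype ι] [DecidableEq ι] in
theorem exists_abs_le_of_continuous {ψ : (ι → I) → ℝ} (hψ : Continuous ψ) :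
    ∃ B, ∀ u, |ψ u| ≤ B := by
  obtain ⟨B, hB⟩ := isCompact_univ.exists_bound_of_continuousOn hψ.continuousOn
  exact ⟨B, fun u => hB u (mem_univ u)⟩

theorem measurable_chi_integrand {ψ : (ι → I) → ℝ} (hψ : Continuous ψ) (K K' : Finset ι)
    {F : (ι → I) → ℝ} (hF : Measurable F) :
    Measurable (Function.uncurry fun (v : K' → I) (w : {i // i ∉ K'} → I) =>
      ψ (glue K' v w) * F (chiPoint K K' v w)) :=
  (hψ.comp (continuous_glue K')).measurable.mul (hF.comp (continuous_chiPoint K K').measurable)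

theorem measurable_chi {ψ : (ι → I) → ℝ} (hψ : Continuous ψ) (K K' : Finset ι)
    {F : (ι → I) → ℝ} (hF : Measurable F) : Measurable (chi ψ K K' F) :=
  (StronglyMeasurable.integral_prod_right
    (measurable_chi_integrand hψ K K' hF).stronglyMeasurable).measurable

theorem integrable_chi_integrand {ψ : (ι → I) → ℝ} (hψ : Continuous ψ) (K K' : Finset ι)
    {F : (ι → I) → ℝ} (hF : Measurable F) {c : ℝ} (hc : ∀ u, |F u| ≤ c) (v : K' → I) :
    Integrable fun w : {i // i ∉ K'} → I => ψ (glue K' v w) * F (chiPoint K K' v w) := by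
  obtain ⟨B, hB⟩ := exists_abs_le_of_continuous hψ
  refine Integrable.of_bound ((measurable_chi_integrand hψ K K' hF).comp
    measurable_prodMk_left).aestronglyMeasurable (B * c) (Eventually.of_forall fun w => ?_)
  change |ψ (glue K' v w) * F (chiPoint K K' v w)| ≤ B * c
  rw [abs_mul]
  exact mul_le_mul (hB _) (hc _) (abs_nonneg _) ((abs_nonneg _).trans (hB 1))

theorem abs_chi_le {ψ : (ι → I) → ℝ} {B : ℝ} (hB : ∀ u, |ψ u| ≤ B) (K K' : Finset ι)
    {F : (ι → I) → ℝ} {c : ℝ} (hc : ∀ u, |F u| ≤ c) (v : K' → I) :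
    |chi ψ K K' F v| ≤ B * c := by
  have := norm_integral_le_of_norm_le_const (μ := (volume : Measure ({i // i ∉ K'} → I)))
    (f := fun w => ψ (glue K' v w) * F (chiPoint K K' v w)) (C := B * c)
    (Eventually.of_forall fun w => by
      rw [Real.norm_eq_abs, abs_mul]
      exact mul_le_mul (hB _) (hc _) (abs_nonneg _) ((abs_nonneg _).trans (hB 1)))
  rwa [probReal_univ, mul_one, Real.norm_eq_abs, ← chi_eq] at this

theorem chi_add {ψ : (ι → I) → ℝ} (hψ : Continuous ψ) (K K' : Finset ι) {F G : (ι → I) → ℝ}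
    (hF : Measurable F) (hG : Measurable G) {c d : ℝ} (hc : ∀ u, |F u| ≤ c)
    (hd : ∀ u, |G u| ≤ d) (v : K' → I) :
    chi ψ K K' (F + G) v = chi ψ K K' F v + chi ψ K K' G v := by
  simp only [chi_eq]
  rw [← integral_add (integrable_chi_integrand hψ K K' hF hc v)
    (integrable_chi_integrand hψ K K' hG hd v)]
  simp only [Pi.add_apply, mul_add]

theorem chi_smul (ψ : (ι → I) → ℝ) (K K' : Finset ι) (t : ℝ) (F : (ι → I) → ℝ) (v : K' → I) :
    chi ψ K K' (t • F) v = t * chi ψ K K' F v := by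
  simp only [chi_eq]
  rw [← integral_const_mul]
  simp only [Pi.smul_apply, smul_eq_mul, mul_left_comm]

theorem integrable_chi {ψ : (ι → I) → ℝ} (hψ : Continuous ψ) (K K' : Finset ι)
    {F : (ι → I) → ℝ} (hF : Measurable F) {c : ℝ} (hc : ∀ u, |F u| ≤ c)
    (μ : Measure (K' → I)) [IsFiniteMeasure μ] : Integrable (chi ψ K K' F) μ := by
  obtain ⟨B, hB⟩ := exists_abs_le_of_continuous hψ
  exact Integrable.of_bound (measurable_chi hψ K K' hF).aestronglyMeasurable (B * c)
    (Eventually.of_forall fun v => abs_chi_le hB K K' hc v)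

/-- The derivative in the integrand, as a continuous linear functional. -/
theorem exists_integral_chi_clm {ψ : (ι → I) → ℝ} (hψ : Continuous ψ) (K K' : Finset ι)
    (μ : Measure (K' → I)) [IsProbabilityMeasure μ] :
    ∃ D : C(ι → I, ℝ) →L[ℝ] ℝ, ∀ h, D h = ∫ v, chi ψ K K' h v ∂μ := by
  obtain ⟨B, hB⟩ := exists_abs_le_of_continuous hψ
  have hmeas : ∀ h : C(ι → I, ℝ), Measurable h := fun h => h.continuous.measurable
  have hbd : ∀ (h : C(ι → I, ℝ)) (u : ι → I), |h u| ≤ ‖h‖ := fun h => h.norm_coe_le_norm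
  refine ⟨LinearMap.mkContinuous ⟨⟨fun h => ∫ v, chi ψ K K' h v ∂μ, fun h h' => ?_⟩,
    fun c h => ?_⟩ B fun h => ?_, fun h => rfl⟩
  · rw [← integral_add (integrable_chi hψ K K' (hmeas h) (hbd h) μ)
      (integrable_chi hψ K K' (hmeas h') (hbd h') μ)]
    refine integral_congr_ae (Eventually.of_forall fun v => ?_)
    exact chi_add hψ K K' (hmeas h) (hmeas h') (hbd h) (hbd h') v
  · rw [RingHom.id_apply, smul_eq_mul, ← integral_const_mul]
    exact integral_congr_ae (Eventually.of_forall fun v => chi_smul ψ K K' c h v)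
  · have := norm_integral_le_of_norm_le_const (μ := μ) (f := chi ψ K K' h) (C := B * ‖h‖)
      (Eventually.of_forall fun v => abs_chi_le hB K K' (hbd h) v)
    rwa [probReal_univ, mul_one] at this

/-! ### Hadamard differentiability -/

/-- The first-order expansion in the integrand. -/
theorem abs_integral_chi_sub_le {ψ : (ι → I) → ℝ} (hψ : Continuous ψ) {B : ℝ}
    (hB : ∀ u, |ψ u| ≤ B) (K K' : Finset ι) {F G H : (ι → I) → ℝ} (hF : Measurable F)
    (hG : Measurable G) (hH : Measurable H) {a b d : ℝ} (ha : ∀ u, |F u| ≤ a)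
    (hb : ∀ u, |G u| ≤ b) (hd : ∀ u, |H u| ≤ d) (μ : Measure (K' → I)) [IsProbabilityMeasure μ]
    {t c : ℝ} (hc : ∀ u, |F u - G u - t * H u| ≤ c) :
    |∫ v, chi ψ K K' F v ∂μ - ∫ v, chi ψ K K' G v ∂μ - t * ∫ v, chi ψ K K' H v ∂μ| ≤ B * c := by
  have hR : Measurable fun u => F u - G u - t * H u := (hF.sub hG).sub (hH.const_mul t)
  have htH : ∀ u, |(t • H) u| ≤ |t| * d := fun u => by
    rw [Pi.smul_apply, smul_eq_mul, abs_mul]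
    exact mul_le_mul_of_nonneg_left (hd u) (abs_nonneg t)
  -- Additivity of `chi` is available for bounded measurable functions, so F is written as remainder
  -- plus linear part, each with its bound.
  have hsum : F = (fun u => F u - G u - t * H u) + (G + t • H) := by
    ext u
    simp
  have hGH : ∀ u, |(G + t • H) u| ≤ b + |t| * d := fun u =>
    (abs_add_le _ _).trans (add_le_add (hb u) (htH u))
  have hchi : ∀ v, chi ψ K K' F v - chi ψ K K' G v - t * chi ψ K K' H v =
      chi ψ K K' (fun u => F u - G u - t * H u) v := fun v => by
    conv_lhs => rw [hsum]
    rw [chi_add hψ K K' hR (hG.add (hH.const_smul t)) hc hGH,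
      chi_add hψ K K' hG (hH.const_smul t) hb htH, chi_smul]
    ring
  have hiF := integrable_chi hψ K K' hF ha μ
  have hiG := integrable_chi hψ K K' hG hb μ
  rw [← integral_const_mul, ← integral_sub hiF hiG,
    ← integral_sub (f := fun v => chi ψ K K' F v - chi ψ K K' G v) (hiF.sub hiG)
      ((integrable_chi hψ K K' hH hd μ).const_mul t)]
  simp only [hchi]
  have := norm_integral_le_of_norm_le_const (μ := μ)
    (f := chi ψ K K' fun u => F u - G u - t * H u) (C := B * c)
    (Eventually.of_forall fun v => abs_chi_le hB K K' hc v)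
  rwa [probReal_univ, mul_one] at this

/-- A difference quotient converges if its first-order expansion has a small remainder. -/
theorem tendsto_div_of_abs_sub_le {a J t : ℕ → ℝ} {V L : ℝ} (ht : ∀ n, t n ≠ 0)
    (h : ∀ ε > 0, ∀ᶠ n in atTop, |a n - t n * J n| ≤ |t n| * ε * V)
    (hJ : Tendsto J atTop (𝓝 L)) : Tendsto (fun n => a n / t n) atTop (𝓝 L) := by
  have hlim : Tendsto (fun n => a n / t n - J n) atTop (𝓝 0) := by
    refine Metric.tendsto_nhds.2 fun η hη => ?_
    -- Dividing by |V| + 1 allows any real V, including 0.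
    filter_upwards [h (η / (|V| + 1)) (by positivity)] with n hn
    have htn : 0 < |t n| := abs_pos.2 (ht n)
    have h1 : a n / t n - J n = (a n - t n * J n) / t n := by
      rw [sub_div, mul_div_cancel_left₀ _ (ht n)]
    rw [Real.dist_eq, sub_zero, h1, abs_div, div_lt_iff₀ htn, mul_comm η]
    refine hn.trans_lt ?_
    rw [mul_assoc]
    refine mul_lt_mul_of_pos_left ?_ htn
    rw [div_mul_eq_mul_div, div_lt_iff₀ (by positivity)]
    exact mul_lt_mul_of_pos_left ((le_abs_self V).trans_lt (lt_add_one _)) hη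
  simpa using hlim.add hJ

theorem margin_empty_eq {F G : (ι → I) → ℝ} (hF : F ∈ cdfs ι) (hG : G ∈ cdfs ι) :
    margin ∅ F = margin ∅ G := by
  obtain ⟨μ, hμ, hFμ⟩ := hF
  obtain ⟨ν, hν, hGν⟩ := hG
  rw [margin_empty, margin_empty, hFμ.apply_one, hGν.apply_one]

theorem eventually_abs_add_smul_sub_le {X : Type*} {C : X → ℝ} {t : ℕ → ℝ}
    {hs : ℕ → X → ℝ} {h : X → ℝ} (hh : TendstoUniformly hs h atTop) {ε : ℝ} (hε : 0 < ε) :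
    ∀ᶠ n in atTop, ∀ u, |(C + t n • hs n) u - C u - t n * h u| ≤ |t n| * ε := by
  filter_upwards [Metric.tendstoUniformly_iff.1 hh ε hε] with n hn u
  have h1 : (C + t n • hs n) u - C u - t n * h u = t n * (hs n u - h u) := by
    simp only [Pi.add_apply, Pi.smul_apply, smul_eq_mul]
    ring
  have h2 := (hn u).le
  rw [dist_comm, Real.dist_eq] at h2
  rw [h1, abs_mul]
  exact mul_le_mul_of_nonneg_left h2 (abs_nonneg _)

/-- The part of the difference quotient that comes from the integrand. -/
theorem tendsto_integrand_part {ψ : (ι → I) → ℝ} (hψ : Continuous ψ) (K K' : Finset ι)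
    {C : (ι → I) → ℝ} (hC : C ∈ cdfs ι) {t : ℕ → ℝ} {hs : ℕ → (ι → I) → ℝ} {h : C(ι → I, ℝ)}
    (ht : ∀ n, t n ≠ 0) (ht0 : Tendsto t atTop (𝓝 0)) (hh : TendstoUniformly hs h atTop)
    (hF : ∀ n, C + t n • hs n ∈ cdfs ι) :
    Tendsto (fun n =>
      (∫ v, chi ψ K K' (C + t n • hs n) v ∂cdfMeasure (margin K' (C + t n • hs n)) -
        ∫ v, chi ψ K K' C v ∂cdfMeasure (margin K' (C + t n • hs n))) / t n) atTop
      (𝓝 (∫ v, chi ψ K K' h v ∂cdfMeasure (margin K' C))) := by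
  obtain ⟨B, hB⟩ := exists_abs_le_of_continuous hψ
  have hp : ∀ n, IsProbabilityMeasure (cdfMeasure (margin K' (C + t n • hs n))) :=
    fun n => (isCdfOf_margin (hF n) K').1
  have hp0 := (isCdfOf_margin hC K').1
  obtain ⟨μ, hμ, hCμ⟩ := id hC
  choose μs hμs hFμ using hF
  -- The integrating measure still varies with n, so the approximants J_n = ∫χ_h dF_{K'} are not
  -- constant; weak convergence gives their limit.
  refine tendsto_div_of_abs_sub_le (V := B) ht (fun ε hε => ?_)
    (tendsto_integral_of_tendsto_cdf
      (μs := fun n => cdfMeasure (margin K' (C + t n • hs n))) (continuous_chi hψ K K' h.continuous) fun v => ?_)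
  · filter_upwards [eventually_abs_add_smul_sub_le (C := C) (t := t) hh hε] with n hn
    rw [mul_comm _ B]
    exact abs_integral_chi_sub_le hψ hB K K' (hFμ n).measurable hCμ.measurable
      h.continuous.measurable (hFμ n).abs_le_one hCμ.abs_le_one h.norm_coe_le_norm _ hn
  · simp only [← (isCdfOf_margin ⟨μs _, hμs _, hFμ _⟩ K').2 v, ← (isCdfOf_margin hC K').2 v]
    have h1 : Tendsto (fun n => C (extendOne K' v) + t n * hs n (extendOne K' v)) atTop
        (𝓝 (C (extendOne K' v) + 0 * h (extendOne K' v))) :=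
      (ht0.mul (hh.tendsto_at _)).const_add _
    rw [zero_mul, add_zero] at h1
    exact h1

/-- The part of the difference quotient that comes from the integrating measure. -/
theorem tendsto_measure_part {K' : Finset ι} {χ : (K' → I) → ℝ} (hχ : Continuous χ)
    (hχ' : IsHardyKrauseBV χ) {C : (ι → I) → ℝ} (hC : C ∈ cdfs ι) {t : ℕ → ℝ}
    {hs : ℕ → (ι → I) → ℝ} {h : (ι → I) → ℝ} (ht : ∀ n, t n ≠ 0)
    (hh : TendstoUniformly hs h atTop) (hF : ∀ n, C + t n • hs n ∈ cdfs ι) {J : ℝ}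
    (hJ : HasIntegralByParts χ (margin K' h) J) :
    Tendsto (fun n => (∫ v, χ v ∂cdfMeasure (margin K' (C + t n • hs n)) -
      ∫ v, χ v ∂cdfMeasure (margin K' C)) / t n) atTop (𝓝 J) := by
  obtain ⟨V, hV⟩ := hχ'.exists_abs_byPartsSum_le
  have hp0 := (isCdfOf_margin hC K').1
  refine tendsto_div_of_abs_sub_le (V := V) ht (fun ε hε => ?_) tendsto_const_nhds
  filter_upwards [eventually_abs_add_smul_sub_le (C := C) (t := t) hh hε] with n hn
  have hp := (isCdfOf_margin (hF n) K').1
  refine abs_integral_sub_integral_sub_le hχ hV hJ _ _ fun v => ?_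
  rw [← (isCdfOf_margin (hF n) K').2 v, ← (isCdfOf_margin hC K').2 v]
  exact hn _

end HadamardCopula

end

/-! ### The main theorem -/

open HadamardCopula in
theorem mainTheorem10 (p : ℕ) (ψ : (Fin p → I) → ℝ) (hψ : Continuous ψ)
    (K K' : Finset (Fin p)) (C : (Fin p → I) → ℝ) (hC : IsCopula C)
    (hχ : IsHardyKrauseBV (chi ψ K K' C)) :
    ∃ D : C(Fin p → I, ℝ) →L[ℝ] ℝ,
      HasHadamardDerivAt (cdfs (Fin p)) (Psi ψ K K') D C ∧
      ∀ h : C(Fin p → I, ℝ), ∃ J : ℝ,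
        HasIntegralByParts (chi ψ K K' C) (margin K' h) J ∧
        (∀ μ₁ μ₂ : Measure (K' → I), IsFiniteMeasure μ₁ → IsFiniteMeasure μ₂ →
          (∀ v, margin K' h v = μ₁.real (Iic v) - μ₂.real (Iic v)) →
          J = ∫ v, chi ψ K K' C v ∂μ₁ - ∫ v, chi ψ K K' C v ∂μ₂) ∧
        D h = (if K = ∅ then 0 else ∫ v, chi ψ K K' h v ∂(cdfMeasure (margin K' C)))
          + (if K' = ∅ then 0 else J) := by
  have hp := (isCdfOf_margin hC.1 K').1
  have hcont : Continuous (chi ψ K K' C) := continuous_chi hψ K K' hC.continuous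
  obtain ⟨D₁, hD₁⟩ := exists_integral_chi_clm hψ K K' (cdfMeasure (margin K' C))
  obtain ⟨D₂, hD₂⟩ := exists_integralByParts_clm hχ (continuous_extendOne K')
  refine ⟨(if K = ∅ then 0 else D₁) + (if K' = ∅ then 0 else D₂),
    fun t hs h ht ht0 hh hF => ?_, fun h => ⟨D₂ h, hD₂ h, fun μ₁ μ₂ _ _ hμ => ?_, ?_⟩⟩
  · have hsplit : ∀ n, (Psi ψ K K' (C + t n • hs n) - Psi ψ K K' C) / t n =
        (∫ v, chi ψ K K' (C + t n • hs n) v ∂cdfMeasure (margin K' (C + t n • hs n)) -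
          ∫ v, chi ψ K K' C v ∂cdfMeasure (margin K' (C + t n • hs n))) / t n +
        (∫ v, chi ψ K K' C v ∂cdfMeasure (margin K' (C + t n • hs n)) -
          ∫ v, chi ψ K K' C v ∂cdfMeasure (margin K' C)) / t n := fun n => by
      rw [Psi, Psi, ← add_div, sub_add_sub_cancel]
    simp only [hsplit]
    refine Tendsto.add ?_ ?_
    -- For K = ∅ the integrand is the same for every cdf, so this quotient is identically 0;
    -- likewise below for K' = ∅ and the measure.
    · split_ifs with hK
      · subst hK
        have hchi : ∀ n, chi ψ ∅ K' (C + t n • hs n) = chi ψ ∅ K' C := fun n => by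
          ext v
          simp only [chi, margin_empty_eq (hF n) hC.1]
        simp [hchi]
      · rw [ContinuousLinearMap.coe_coe, hD₁]
        exact tendsto_integrand_part hψ K K' hC.1 ht ht0 hh hF
    · split_ifs with hK'
      · subst hK'
        simp [margin_empty_eq (hF _) hC.1]
      · exact tendsto_measure_part hcont hχ hC.1 ht hh hF (hD₂ h)
  -- The cdf difference is exactly the margin of h, so the stability bound holds with c = 0 and
  -- becomes an equality.
  · have := abs_integral_sub_integral_sub_le (t := 1) (c := 0) hcont
      hχ.exists_abs_byPartsSum_le.choose_spec (hD₂ h) μ₁ μ₂ fun v => by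
        rw [← hμ v, one_mul, margin_eq_comp, sub_self, abs_zero]
    rw [zero_mul, one_mul] at this
    linarith [abs_nonpos_iff.1 this]
  · split_ifs <;> simp [hD₁]
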